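/- Let $k\ge 1$ and let $\Lambda$ be a $k$-graph: a countable category with objects (vertices) $\Lambda^0$, morphisms (paths) $\Lambda$, range and source maps $r,s$, and a degree functor $d:\Lambda\to\mathbb{N}^k$ such that whenever $d(\lambda)=m+n$ there are unique $\mu,\nu\in\Lambda$ with $s(\mu)=r(\nu)$, $d(\mu)=m$, $d(\nu)=n$ and $\lambda=\mu\nu$; vertices are identified with the paths of degree $0$. Write $v\Lambda^n=\{\lambda\in\Lambda: r(\lambda)=v,\ d(\lambda)=n\}$, and assume that $\Lambda$ is row-finite with no sources, i.e. every $v\Lambda^n$ ($v\in\Lambda^0$, $n\in\mathbb{N}^k$) is finite and non-empty. Let $R$ be a commutative ring with $1$. Let $\mathrm{KP}_R(\Lambda)$ be the Kumjian–Pask algebra of $\Lambda$, i.e. the universal (not necessarily unital) associative $R$-algebra generated by elements $p_v$ ($v\in\Lambda^0$) and $s_\lambda, s_{\lambda^*}$ ($\lambda\in\Lambda$, $d(\lambda)\neq0$) subject to the relations: 1. the $p_v$ are mutually orthogonal idempotents; 2. for $\lambda,\mu$ of non-zero degree with $s(\lambda)=r(\mu)$: $s_\lambda s_\mu=s_{\lambda\mu}$,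 $s_{\mu^*}s_{\lambda^*}=s_{(\lambda\mu)^*}$; and for $\lambda$ of non-zero degree: $p_{r(\lambda)}s_\lambda=s_\lambda=s_\lambda p_{s(\lambda)}$, $p_{s(\lambda)}s_{\lambda^*}=s_{\lambda^*}=s_{\lambda^*}p_{r(\lambda)}$; 3. $s_{\lambda^*}s_\mu=\delta_{\lambda,\mu}\,p_{s(\lambda)}$ for $\lambda,\mu$ of equal non-zero degree; 4. $p_v=\sum_{\lambda\in v\Lambda^n}s_\lambda s_{\lambda^*}$ for $v\in\Lambda^0$ and $n\in\mathbb{N}^k\setminus\{0\}$. Put $s_v=s_{v^*}=p_v$ for $v\in\Lambda^0$. Subalgebras are $R$-subalgebras, not necessarily unital. Let $\mathcal{D}$ be the subalgebra of $\mathrm{KP}_R(\Lambda)$ generated by $\{s_\mu s_{\mu^*}:\mu\in\Lambda\}$ (the diagonal subalgebra), and let $\mathcal{D}'=\{a\in\mathrm{KP}_R(\Lambda): ad=da\text{ for all }d\in\mathcal{D}\}$. A pair $(\alpha,\beta)\in\Lambda\times\Lambda$ with $s(\alpha)=s(\beta)$ is called cycline if $s_{\alpha\gamma}s_{(\alpha\gamma)^*}=s_{\beta\gamma}s_{(\beta\gamma)^*}$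 for every $\gamma\in\Lambda$ with $r(\gamma)=s(\alpha)$. Let $\mathcal{M}$ be the subalgebra generated by $\{s_\alpha s_{\beta^*}:(\alpha,\beta)\text{ cycline}\}$ (the cycline subalgebra). Then $\mathcal{M}=\mathcal{D}'$. In particular, $\mathcal{M}$ is a maximal commutative subalgebra of $\mathrm{KP}_R(\Lambda)$: it is commutative, and every commutative subalgebra of $\mathrm{KP}_R(\Lambda)$ that contains $\mathcal{M}$ equals $\mathcal{M}$. -/

import Mathlib

open CategoryTheory

namespace KumjianPask

universe u w x y

/-- A path (morphism) `λ` of a category `V`, bundled with its source `s(λ)` and its range `r(λ)`.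
Composition in the order `λμ`, for `s(λ) = r(μ)`, is Mathlib's `μ.hom ≫ λ.hom`. -/
@[ext]
structure Path (V : Type u) [Category.{w} V] where
  /-- the source `s(λ)` -/
  {src : V}
  /-- the range `r(λ)` -/
  {ran : V}
  /-- the morphism itself -/
  hom : src ⟶ ran

/-- The vertex `v`, regarded as a path (the identity morphism at `v`). -/
def Path.vertex {V : Type u} [Category.{w} V] (v : V) : Path V := ⟨𝟙 v⟩

/-- A `k`-graph on the category `V` (objects are the vertices, morphisms the paths): countably many
paths, and a degree functor to `ℕ^k` with the unique factorization property. -/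
structure KGraph (k : ℕ) (V : Type u) [Category.{w} V] where
  /-- there are countably many paths (hence countably many vertices) -/
  countable_path : Countable (Path V)
  /-- the degree map -/
  deg : Path V → (Fin k → ℕ)
  deg_vertex : ∀ v : V, deg (Path.vertex v) = 0
  /-- `d(λμ) = d(λ) + d(μ)` -/
  deg_comp : ∀ {a b c : V} (l : b ⟶ c) (m : a ⟶ b), deg ⟨m ≫ l⟩ = deg ⟨l⟩ + deg ⟨m⟩
  /-- if `d(λ) = m + n`, there is exactly one pair of paths `μ, ν` with `s(μ) = r(ν)`,
  `d(μ) = m`, `d(ν) = n` and `λ = μν` (here `p = (s(μ), ν, μ)`) -/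
  factorization : ∀ {a c : V} (l : a ⟶ c) (m n : Fin k → ℕ), deg ⟨l⟩ = m + n →
    ∃! p : Σ b : V, (a ⟶ b) × (b ⟶ c),
      deg ⟨p.2.2⟩ = m ∧ deg ⟨p.2.1⟩ = n ∧ p.2.1 ≫ p.2.2 = l

section Graph

variable {k : ℕ} {V : Type u} [Category.{w} V]

/-- The set `vΛ^n` of paths of degree `n` with range `v`. -/
def KGraph.pathsTo (G : KGraph k V) (v : V) (n : Fin k → ℕ) : Set (Path V) :=
  {l | l.ran = v ∧ G.deg l = n}

/-- Row-finite: every `vΛ^n` is finite. -/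
def KGraph.RowFinite (G : KGraph k V) : Prop :=
  ∀ (v : V) (n : Fin k → ℕ), (G.pathsTo v n).Finite

/-- No sources: every `vΛ^n` is non-empty. -/
def KGraph.NoSources (G : KGraph k V) : Prop :=
  ∀ (v : V) (n : Fin k → ℕ), (G.pathsTo v n).Nonempty

/-- `Relation G P S T a b` says that the equation `a = b` is one of the Kumjian-Pask relations
(KP1)-(KP4) for `P_v = P v`, `S_λ = S λ` and `S_{λ^*} = T λ`, or an instance of the convention
`S_v = P_v = S_{v^*}` through which `S` and `T` are defined on all paths and not only on those of
non-zero degree. -/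
inductive Relation (G : KGraph k V) {A : Type x} [NonUnitalRing A]
    (P : V → A) (S T : Path V → A) : A → A → Prop
  | S_vertex (v : V) : Relation G P S T (S (Path.vertex v)) (P v)
  | T_vertex (v : V) : Relation G P S T (T (Path.vertex v)) (P v)
  /-- (KP1) -/
  | P_idem (v : V) : Relation G P S T (P v * P v) (P v)
  | P_orth {v v' : V} : v ≠ v' → Relation G P S T (P v * P v') 0
  /-- (KP2) -/
  | S_mul {a b c : V} (l : b ⟶ c) (m : a ⟶ b) : G.deg ⟨l⟩ ≠ 0 → G.deg ⟨m⟩ ≠ 0 →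
      Relation G P S T (S ⟨l⟩ * S ⟨m⟩) (S ⟨m ≫ l⟩)
  | T_mul {a b c : V} (l : b ⟶ c) (m : a ⟶ b) : G.deg ⟨l⟩ ≠ 0 → G.deg ⟨m⟩ ≠ 0 →
      Relation G P S T (T ⟨m⟩ * T ⟨l⟩) (T ⟨m ≫ l⟩)
  | P_mul_S (l : Path V) : G.deg l ≠ 0 → Relation G P S T (P l.ran * S l) (S l)
  | S_mul_P (l : Path V) : G.deg l ≠ 0 → Relation G P S T (S l * P l.src) (S l)
  | P_mul_T (l : Path V) : G.deg l ≠ 0 → Relation G P S T (P l.src * T l) (T l)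
  | T_mul_P (l : Path V) : G.deg l ≠ 0 → Relation G P S T (T l * P l.ran) (T l)
  /-- (KP3) -/
  | T_mul_S (l : Path V) : G.deg l ≠ 0 → Relation G P S T (T l * S l) (P l.src)
  | T_mul_S_ne {l m : Path V} : G.deg l ≠ 0 → G.deg m ≠ 0 → G.deg l = G.deg m → l ≠ m →
      Relation G P S T (T l * S m) 0
  /-- (KP4); the finite set `F` is `vΛ^n` -/
  | P_eq_sum (v : V) (n : Fin k → ℕ) (F : Finset (Path V)) : n ≠ 0 →
      (F : Set (Path V)) = G.pathsTo v n → Relation G P S T (P v) (∑ l ∈ F, S l * T l)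

/-- `(P, S, T)` is a Kumjian-Pask `G`-family in the (not necessarily unital) ring `A`; `T l` is the
value at the ghost path `l^*`. -/
def IsFamily (G : KGraph k V) {A : Type x} [NonUnitalRing A]
    (P : V → A) (S T : Path V → A) : Prop :=
  ∀ a b : A, Relation G P S T a b → a = b

variable (V) in
/-- The symbols `p_v`, `s_λ` and `s_{λ^*}`. -/
inductive Gen : Type (max u w)
  | vertex (v : V) : Gen
  | path (l : Path V) : Gen
  | ghost (l : Path V) : Gen

end Graph

/-- The free (associative, non-unital) `R`-algebra on a set `X`. -/
abbrev FreeAlg (R : Type y) [CommRing R] (X : Type x) : Type (max x y) :=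
  MonoidAlgebra R (FreeSemigroup X)

noncomputable section Algebra

variable (R : Type y) [CommRing R]

/-- A generator of the free non-unital algebra. -/
def FreeAlg.of {X : Type x} (a : X) : FreeAlg R X :=
  MonoidAlgebra.single (FreeSemigroup.of a) 1

variable {k : ℕ} {V : Type u} [Category.{w} V] (G : KGraph k V)

/-- Generates the smallest `R`-algebra congruence on the free algebra that contains all the
Kumjian-Pask relations between the symbols `p_v`, `s_λ`, `s_{λ^*}`. -/
inductive Rel : FreeAlg R (Gen V) → FreeAlg R (Gen V) → Prop
  | base {a b : FreeAlg R (Gen V)} :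
      Relation G (fun v => FreeAlg.of R (Gen.vertex v)) (fun l => FreeAlg.of R (Gen.path l))
        (fun l => FreeAlg.of R (Gen.ghost l)) a b → Rel a b
  | smul (t : R) {a b : FreeAlg R (Gen V)} : Rel a b → Rel (t • a) (t • b)
  | add_right {a b : FreeAlg R (Gen V)} (c : FreeAlg R (Gen V)) : Rel a b → Rel (a + c) (b + c)
  | mul_left (a : FreeAlg R (Gen V)) {b c : FreeAlg R (Gen V)} : Rel b c → Rel (a * b) (a * c)
  | mul_right {a b : FreeAlg R (Gen V)} (c : FreeAlg R (Gen V)) : Rel a b → Rel (a * c) (b * c)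

variable {R G} in
theorem Rel.add_left (a : FreeAlg R (Gen V)) {b c : FreeAlg R (Gen V)} (h : Rel R G b c) :
    Rel R G (a + b) (a + c) := by
  rw [add_comm _ b, add_comm _ c]; exact h.add_right _

variable {R G} in
theorem Rel.neg {a b : FreeAlg R (Gen V)} (h : Rel R G a b) : Rel R G (-a) (-b) := by
  simpa only [neg_one_smul] using h.smul (-1)

variable {R G} in
theorem Rel.sub_left (a : FreeAlg R (Gen V)) {b c : FreeAlg R (Gen V)} (h : Rel R G b c) :
    Rel R G (a - b) (a - c) := by
  simpa only [sub_eq_add_neg] using h.neg.add_left a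

variable {R G} in
theorem Rel.sub_right {a b : FreeAlg R (Gen V)} (c : FreeAlg R (Gen V)) (h : Rel R G a b) :
    Rel R G (a - c) (b - c) := by
  simpa only [sub_eq_add_neg] using h.add_right (-c)

variable {R G} in
theorem Rel.smul_tower {M : Type*} [Monoid M] [DistribMulAction M R] [IsScalarTower M R R] (t : M)
    {a b : FreeAlg R (Gen V)} (h : Rel R G a b) : Rel R G (t • a) (t • b) := by
  rw [← smul_one_smul R t a, ← smul_one_smul R t b]
  exact h.smul _

/-- The Kumjian-Pask algebra `KP_R(Λ)`, as the free non-unital `R`-algebra on the symbols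
`p_v`, `s_λ`, `s_{λ^*}` modulo the Kumjian-Pask relations. -/
def KPAlgebra : Type (max u w y) := Quot (Rel R G)

namespace KPAlgebra

instance : Zero (KPAlgebra R G) where zero := Quot.mk _ 0

instance : Add (KPAlgebra R G) where
  add := Quot.map₂ (· + ·) (fun _ _ _ => Rel.add_left _) fun _ _ _ => Rel.add_right _

instance : Neg (KPAlgebra R G) where neg := Quot.map Neg.neg fun _ _ => Rel.neg

instance : Sub (KPAlgebra R G) where
  sub := Quot.map₂ Sub.sub (fun _ _ _ => Rel.sub_left _) fun _ _ _ => Rel.sub_right _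

instance : Mul (KPAlgebra R G) where
  mul := Quot.map₂ (· * ·) (fun _ _ _ => Rel.mul_left _) fun _ _ _ => Rel.mul_right _

instance {M : Type*} [Monoid M] [DistribMulAction M R] [IsScalarTower M R R] :
    SMul M (KPAlgebra R G) where
  smul t := Quot.map (t • ·) (fun _ _ => Rel.smul_tower t)

instance : NonUnitalRing (KPAlgebra R G) :=
  Function.Surjective.nonUnitalRing (Quot.mk (Rel R G)) Quot.mk_surjective rfl
    (fun _ _ => rfl) (fun _ _ => rfl) (fun _ => rfl) (fun _ _ => rfl) (fun _ _ => rfl)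
    (fun _ _ => rfl)

instance : Module R (KPAlgebra R G) :=
  Function.Surjective.module R ⟨⟨Quot.mk (Rel R G), rfl⟩, fun _ _ => rfl⟩
    Quot.mk_surjective (fun _ _ => rfl)

instance : IsScalarTower R (KPAlgebra R G) (KPAlgebra R G) where
  smul_assoc := by
    rintro t ⟨a⟩ ⟨b⟩
    exact congrArg (Quot.mk (Rel R G)) (smul_mul_assoc t a b)

instance : SMulCommClass R (KPAlgebra R G) (KPAlgebra R G) where
  smul_comm := by
    rintro t ⟨a⟩ ⟨b⟩
    exact congrArg (Quot.mk (Rel R G)) (mul_smul_comm t a b).symm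

/-- The quotient map from the free algebra. -/
def mk : FreeAlg R (Gen V) →ₙₐ[R] KPAlgebra R G where
  toFun := Quot.mk (Rel R G)
  map_smul' _ _ := rfl
  map_zero' := rfl
  map_add' _ _ := rfl
  map_mul' _ _ := rfl

/-- The generator `p_v`. -/
def p (v : V) : KPAlgebra R G := mk R G (FreeAlg.of R (Gen.vertex v))

/-- The generator `s_λ` (with `s_v = p_v` for vertices). -/
def s (l : Path V) : KPAlgebra R G := mk R G (FreeAlg.of R (Gen.path l))

/-- The generator `s_{λ^*}` (with `s_{v^*} = p_v` for vertices). -/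
def sStar (l : Path V) : KPAlgebra R G := mk R G (FreeAlg.of R (Gen.ghost l))

end KPAlgebra

variable {R G} in
/-- Homomorphisms preserve the Kumjian-Pask relations. -/
theorem Relation.map {A : Type*} {B : Type*} [NonUnitalRing A] [NonUnitalRing B]
    [Module R A] [Module R B] (φ : A →ₙₐ[R] B)
    {P : V → A} {S T : Path V → A} {a b : A} (h : Relation G P S T a b) :
    Relation G (fun v => φ (P v)) (fun l => φ (S l)) (fun l => φ (T l)) (φ a) (φ b) := by
  cases h with
  | P_eq_sum v n F hn hF =>
    simp only [map_sum, map_mul]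
    exact Relation.P_eq_sum v n F hn hF
  | S_vertex v => exact Relation.S_vertex v
  | T_vertex v => exact Relation.T_vertex v
  | P_idem v => rw [map_mul]; exact Relation.P_idem v
  | P_orth h => rw [map_mul, map_zero]; exact Relation.P_orth h
  | S_mul l m h h' => rw [map_mul]; exact Relation.S_mul l m h h'
  | T_mul l m h h' => rw [map_mul]; exact Relation.T_mul l m h h'
  | P_mul_S l h => rw [map_mul]; exact Relation.P_mul_S l h
  | S_mul_P l h => rw [map_mul]; exact Relation.S_mul_P l h
  | P_mul_T l h => rw [map_mul]; exact Relation.P_mul_T l h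
  | T_mul_P l h => rw [map_mul]; exact Relation.T_mul_P l h
  | T_mul_S l h => rw [map_mul]; exact Relation.T_mul_S l h
  | T_mul_S_ne h h' h₁ h₂ =>
    rw [map_mul, map_zero]; exact Relation.T_mul_S_ne h h' h₁ h₂

/-- `(p, s)` is a Kumjian-Pask family in `KP_R(Λ)`. -/
theorem KPAlgebra.isFamily :
    IsFamily G (KPAlgebra.p R G) (KPAlgebra.s R G) (KPAlgebra.sStar R G) := by
  intro a b h
  have key : ∀ a' b' : FreeAlg R (Gen V),
      Relation G (fun v => FreeAlg.of R (Gen.vertex v)) (fun l => FreeAlg.of R (Gen.path l))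
        (fun l => FreeAlg.of R (Gen.ghost l)) a' b' →
      KPAlgebra.mk R G a' = KPAlgebra.mk R G b' := fun a' b' h => Quot.sound (Rel.base h)
  cases h with
  | P_eq_sum v n F hn hF =>
    have := key _ _ (Relation.P_eq_sum v n F hn hF)
    simp only [map_sum, map_mul] at this
    exact this
  | S_vertex v => exact key _ _ (Relation.S_vertex v)
  | T_vertex v => exact key _ _ (Relation.T_vertex v)
  | P_idem v => exact key _ _ (Relation.P_idem v)
  | P_orth h => exact key _ _ (Relation.P_orth h)
  | S_mul l m h h' => exact key _ _ (Relation.S_mul l m h h')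
  | T_mul l m h h' => exact key _ _ (Relation.T_mul l m h h')
  | P_mul_S l h => exact key _ _ (Relation.P_mul_S l h)
  | S_mul_P l h => exact key _ _ (Relation.S_mul_P l h)
  | P_mul_T l h => exact key _ _ (Relation.P_mul_T l h)
  | T_mul_P l h => exact key _ _ (Relation.T_mul_P l h)
  | T_mul_S l h => exact key _ _ (Relation.T_mul_S l h)
  | T_mul_S_ne h h' h₁ h₂ => exact key _ _ (Relation.T_mul_S_ne h h' h₁ h₂)

/-- The universal property of `KP_R(Λ)`: each Kumjian-Pask family in an `R`-algebra comes from
exactly one `R`-algebra homomorphism. -/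
theorem KPAlgebra.existsUnique_hom {A : Type*} [NonUnitalRing A] [Module R A]
    [IsScalarTower R A A] [SMulCommClass R A A] {P : V → A} {S T : Path V → A}
    (h : IsFamily G P S T) :
    ∃! φ : KPAlgebra R G →ₙₐ[R] A, (∀ v, φ (KPAlgebra.p R G v) = P v) ∧
      (∀ l, φ (KPAlgebra.s R G l) = S l) ∧ ∀ l, φ (KPAlgebra.sStar R G l) = T l := by
  let g : Gen V → A := fun a => match a with
    | Gen.vertex v => P v
    | Gen.path l => S l
    | Gen.ghost l => T l
  let ψ : FreeAlg R (Gen V) →ₙₐ[R] A := MonoidAlgebra.liftMagma R (FreeSemigroup.lift g)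
  have hψ : ∀ a, ψ (FreeAlg.of R a) = g a := by
    intro a
    simp [ψ, FreeAlg.of]
  have hrel : ∀ a b, Rel R G a b → ψ a = ψ b := by
    intro a b hab
    induction hab with
    | base hb =>
      have := hb.map ψ
      simp only [hψ] at this
      exact h _ _ this
    | smul t _ ih => simp only [map_smul, ih]
    | add_right c _ ih => simp only [map_add, ih]
    | mul_left a _ ih => simp only [map_mul, ih]
    | mul_right c _ ih => simp only [map_mul, ih]
  refine ⟨{ toFun := Quot.lift ψ hrel
            map_smul' := ?_, map_zero' := map_zero ψ, map_add' := ?_, map_mul' := ?_ }, ?_, ?_⟩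
  · rintro t ⟨a⟩; exact map_smul ψ t a
  · rintro ⟨a⟩ ⟨b⟩; exact map_add ψ a b
  · rintro ⟨a⟩ ⟨b⟩; exact map_mul ψ a b
  · exact ⟨fun v => hψ (Gen.vertex v), fun l => hψ (Gen.path l), fun l => hψ (Gen.ghost l)⟩
  · rintro φ ⟨h₁, h₂, h₃⟩
    have hφ : φ.comp (KPAlgebra.mk R G) = ψ := by
      apply MonoidAlgebra.nonUnitalAlgHom_ext'
      apply FreeSemigroup.hom_ext
      funext a
      have : φ (KPAlgebra.mk R G (FreeAlg.of R a)) = ψ (FreeAlg.of R a) := by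
        rw [hψ]
        cases a with
        | vertex v => exact h₁ v
        | path l => exact h₂ l
        | ghost l => exact h₃ l
      exact this
    ext ⟨a⟩
    exact DFunLike.congr_fun hφ a

/-- The diagonal subalgebra `𝓓`, generated by the elements `s_μ s_{μ^*}`. -/
def diagonal : NonUnitalSubalgebra R (KPAlgebra R G) :=
  NonUnitalAlgebra.adjoin R
    {a | ∃ m : Path V, a = KPAlgebra.s R G m * KPAlgebra.sStar R G m}

/-- A pair of paths `α, β` with the same source is cycline if
`s_{αγ} s_{(αγ)^*} = s_{βγ} s_{(βγ)^*}` for every path `γ` with range `s(α)`. -/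
def IsCyclinePair {v a b : V} (α : v ⟶ a) (β : v ⟶ b) : Prop :=
  ∀ (c : V) (γ : c ⟶ v),
    KPAlgebra.s R G ⟨γ ≫ α⟩ * KPAlgebra.sStar R G ⟨γ ≫ α⟩ =
      KPAlgebra.s R G ⟨γ ≫ β⟩ * KPAlgebra.sStar R G ⟨γ ≫ β⟩

/-- The cycline subalgebra `𝓜`, generated by the elements `s_α s_{β^*}` for `(α, β)` cycline. -/
def cycline : NonUnitalSubalgebra R (KPAlgebra R G) :=
  NonUnitalAlgebra.adjoin R
    {x | ∃ (v a b : V) (α : v ⟶ a) (β : v ⟶ b), IsCyclinePair R G α β ∧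
      x = KPAlgebra.s R G ⟨α⟩ * KPAlgebra.sStar R G ⟨β⟩}

/-- The commutant `𝓓'` of the diagonal: all elements that commute with each element of `𝓓`. -/
def diagonalCommutant : NonUnitalSubalgebra R (KPAlgebra R G) :=
  NonUnitalSubalgebra.centralizer R (diagonal R G : Set (KPAlgebra R G))

end Algebra

end KumjianPask

/-! Let the algebra act on functions of pairs (x, n), with x an infinite path and n in ℤ^k: s_α
s_{β^*} (where s(α) = s(β)) sends the point mass at (βz, n) to the one at (αz, n + d(α) - d(β)), and
s_μ s_{μ^*} is multiplication by the indicator of the cylinder of paths that begin with μ. The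
coordinate n records degrees; without it a cycline s_α s_{β^*} would act just as s_α s_{α^*} does.

Every element is a combination of terms s_α s_{β^*} with one common value of d(β)
(`exists_normalForm`), and suitable point masses isolate each coefficient of such a combination
(`rep_normalForm_apply`). So the action is faithful (`rep_injective`), and identities can be checked
on functions.

An element commuting with all cylinder indicators can have a term s_α s_{β^*} with non-zero
coefficient only if αz and βz lie in the same cylinders, that is αz = βz, for all z. Then (α, β) is
cycline, whence 𝓓' ⊆ 𝓜. Conversely, a cycline s_α s_{β^*} fixes x and only restricts to a cylinder
and translates n; such operators commute, so 𝓜 is commutative. As 𝓓 ⊆ 𝓜, also 𝓜 ⊆ 𝓓', and a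
commutative subalgebra containing 𝓜 lies in 𝓓' = 𝓜. -/

namespace KumjianPask

universe u w x y

/-! ### Initial segments and unique factorization. -/

section Paths

variable {k : ℕ} {V : Type u} [Category.{w} V]

/-- `l.IsPrefix m` says that `m = lγ` for some path `γ`. -/
def Path.IsPrefix (l m : Path V) : Prop := ∃ (a : V) (γ : a ⟶ l.src), m = ⟨γ ≫ l.hom⟩

theorem Path.IsPrefix.comp {a b c : V} (γ : a ⟶ b) (l : b ⟶ c) :
    (⟨l⟩ : Path V).IsPrefix ⟨γ ≫ l⟩ := ⟨a, γ, rfl⟩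

theorem Path.IsPrefix.refl (l : Path V) : l.IsPrefix l := ⟨l.src, 𝟙 _, by simp⟩

theorem Path.IsPrefix.trans {l m n : Path V} (h : l.IsPrefix m) (h' : m.IsPrefix n) :
    l.IsPrefix n := by
  obtain ⟨a, γ, rfl⟩ := h
  obtain ⟨b, δ, rfl⟩ := h'
  exact ⟨b, δ ≫ γ, by simp⟩

theorem Path.IsPrefix.ran_eq {l m : Path V} (h : l.IsPrefix m) : l.ran = m.ran := by
  obtain ⟨a, γ, rfl⟩ := h
  rfl

theorem Path.vertex_isPrefix (l : Path V) : (Path.vertex l.ran).IsPrefix l :=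
  ⟨l.src, l.hom, by simp [Path.vertex]⟩

theorem Path.IsPrefix.comp_left {a b v c : V} {γ : a ⟶ v} {δ : b ⟶ v}
    (h : (⟨γ⟩ : Path V).IsPrefix ⟨δ⟩) (l : v ⟶ c) :
    (⟨γ ≫ l⟩ : Path V).IsPrefix ⟨δ ≫ l⟩ := by
  obtain ⟨d, ε, hε⟩ := h
  cases hε
  exact ⟨_, ε, by simp⟩

theorem Path.vertex_injective {v v' : V} (h : (Path.vertex v) = Path.vertex v') : v = v' :=
  congrArg Path.src h

variable (G : KGraph k V)

/-- Factorizations with equal initial degrees agree. -/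
theorem KGraph.comp_inj {a b b' a' c c' : V} {l : b ⟶ c} {m : a ⟶ b} {l' : b' ⟶ c'}
    {m' : a' ⟶ b'} (h : (⟨m ≫ l⟩ : Path V) = ⟨m' ≫ l'⟩) (hd : G.deg ⟨l⟩ = G.deg ⟨l'⟩) :
    (⟨l⟩ : Path V) = ⟨l'⟩ ∧ (⟨m⟩ : Path V) = ⟨m'⟩ := by
  obtain rfl : a = a' := congrArg Path.src h
  obtain rfl : c = c' := congrArg Path.ran h
  have h2 : m ≫ l = m' ≫ l' := by
    rw [Path.mk.injEq] at h
    exact eq_of_heq h.2.2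
  have hm : G.deg ⟨m⟩ = G.deg ⟨m'⟩ := by
    have h3 := congrArg G.deg h
    rw [G.deg_comp, G.deg_comp, hd] at h3
    exact add_left_cancel h3
  obtain ⟨p, -, hp⟩ := G.factorization (m ≫ l) _ _ (G.deg_comp l m)
  -- The middle vertices b and b' may differ a priori; uniqueness of the whole triple identifies
  -- them along with the factors.
  have h4 := (hp ⟨b, m, l⟩ ⟨rfl, rfl, rfl⟩).trans (hp ⟨b', m', l'⟩ ⟨hd.symm, hm.symm, h2.symm⟩).symm
  cases h4
  exact ⟨rfl, rfl⟩

theorem KGraph.prefix_unique {l l' m : Path V} (h : l.IsPrefix m) (h' : l'.IsPrefix m)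
    (hd : G.deg l = G.deg l') : l = l' := by
  obtain ⟨a, γ, rfl⟩ := h
  obtain ⟨b, δ, hδ⟩ := h'
  exact (G.comp_inj hδ hd).1

theorem KGraph.exists_prefix (l : Path V) (n : Fin k → ℕ) (h : n ≤ G.deg l) :
    ∃ m : Path V, m.IsPrefix l ∧ G.deg m = n := by
  obtain ⟨⟨b, m, l'⟩, ⟨h1, -, h3⟩, -⟩ := G.factorization l.hom n (G.deg l - n)
    (add_tsub_cancel_of_le h).symm
  refine ⟨⟨l'⟩, ⟨_, m, ?_⟩, h1⟩
  change _ = (⟨m ≫ l'⟩ : Path V)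
  rw [show m ≫ l' = l.hom from h3]

theorem KGraph.eq_vertex {l : Path V} (h : G.deg l = 0) : l = Path.vertex l.ran :=
  G.prefix_unique (Path.IsPrefix.refl l) (Path.vertex_isPrefix l) (h.trans (G.deg_vertex _).symm)

/-! ### Infinite paths, and adding or removing an initial segment. -/

/-- An infinite path, given as the set of its finite initial segments. -/
@[ext]
structure InfinitePath where
  /-- the finite initial segments -/
  segments : Set (Path V)
  prefix_mem : ∀ {l m : Path V}, l.IsPrefix m → m ∈ segments → l ∈ segments
  deg_inj : ∀ {l m : Path V}, l ∈ segments → m ∈ segments → G.deg l = G.deg m → l = m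
  exists_mem : ∀ n, ∃ l ∈ segments, G.deg l = n

namespace InfinitePath

variable {G}

instance : Membership (Path V) (InfinitePath G) := ⟨fun x l => l ∈ x.segments⟩

theorem ext_mem {x y : InfinitePath G} (h : ∀ l, l ∈ x ↔ l ∈ y) : x = y :=
  InfinitePath.ext (Set.ext h)

theorem mem_of_prefix {x : InfinitePath G} {l m : Path V} (h : l.IsPrefix m) (hm : m ∈ x) :
    l ∈ x := x.prefix_mem h hm

theorem eq_of_deg_eq {x : InfinitePath G} {l m : Path V} (hl : l ∈ x) (hm : m ∈ x)
    (hd : G.deg l = G.deg m) : l = m := x.deg_inj hl hm hd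

theorem exists_deg (x : InfinitePath G) (n : Fin k → ℕ) : ∃ l ∈ x, G.deg l = n := x.exists_mem n

theorem vertex_mem {x : InfinitePath G} {l : Path V} (h : l ∈ x) : Path.vertex l.ran ∈ x :=
  mem_of_prefix (Path.vertex_isPrefix l) h

theorem ran_eq {x : InfinitePath G} {l : Path V} {v : V} (h : l ∈ x) (hv : Path.vertex v ∈ x) :
    l.ran = v :=
  Path.vertex_injective (eq_of_deg_eq (vertex_mem h) hv (by rw [G.deg_vertex, G.deg_vertex]))

theorem isPrefix_of_le {x : InfinitePath G} {l m : Path V} (hl : l ∈ x) (hm : m ∈ x)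
    (hd : G.deg l ≤ G.deg m) : l.IsPrefix m := by
  obtain ⟨n, hn, hnd⟩ := G.exists_prefix m _ hd
  rwa [eq_of_deg_eq hl (mem_of_prefix hn hm) hnd.symm]

theorem exists_common {x : InfinitePath G} {l m : Path V} (hl : l ∈ x) (hm : m ∈ x) :
    ∃ n ∈ x, l.IsPrefix n ∧ m.IsPrefix n := by
  obtain ⟨n, hn, hd⟩ := x.exists_deg (G.deg l ⊔ G.deg m)
  exact ⟨n, hn, isPrefix_of_le hl hn (hd ▸ le_sup_left), isPrefix_of_le hm hn (hd ▸ le_sup_right)⟩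

theorem exists_deg_of_vertex {x : InfinitePath G} {v : V} (hv : Path.vertex v ∈ x)
    (n : Fin k → ℕ) : ∃ (a : V) (γ : a ⟶ v), (⟨γ⟩ : Path V) ∈ x ∧ G.deg ⟨γ⟩ = n := by
  obtain ⟨⟨γ⟩, h, hd⟩ := x.exists_deg n
  obtain rfl := ran_eq h hv
  exact ⟨_, γ, h, hd⟩

open Classical in
/-- The infinite path `lx`, if `r(x) = s(l)` (and `x` otherwise). -/
noncomputable def push (l : Path V) (x : InfinitePath G) : InfinitePath G :=
  -- The default value x is harmless: `ghostOp` consults `push l x` only under this condition, and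
  -- `pathOp` consults `pull l x` only when l ∈ x.
  if h : Path.vertex l.src ∈ x then
  { segments := {m | ∃ (a : V) (γ : a ⟶ l.src), (⟨γ⟩ : Path V) ∈ x ∧ m.IsPrefix ⟨γ ≫ l.hom⟩}
    prefix_mem := by
      rintro m n hmn ⟨a, γ, hγ, hn⟩
      exact ⟨a, γ, hγ, hmn.trans hn⟩
    deg_inj := by
      rintro m n ⟨a, γ, hγ, hm⟩ ⟨b, δ, hδ, hn⟩ hd
      obtain ⟨⟨ε⟩, hε, h1, h2⟩ := exists_common hγ hδ
      obtain rfl := ran_eq hε h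
      exact G.prefix_unique (hm.trans (h1.comp_left l.hom)) (hn.trans (h2.comp_left l.hom)) hd
    exists_mem := by
      intro n
      obtain ⟨a, γ, hγ, hd⟩ := exists_deg_of_vertex h n
      obtain ⟨m, hm, hmd⟩ := G.exists_prefix ⟨γ ≫ l.hom⟩ n (by
        rw [G.deg_comp, hd]; exact le_add_self)
      exact ⟨m, ⟨a, γ, hγ, hm⟩, hmd⟩ }
  else x

theorem mem_push {l : Path V} {x : InfinitePath G} (h : Path.vertex l.src ∈ x) {m : Path V} :
    m ∈ push l x ↔ ∃ (a : V) (γ : a ⟶ l.src), (⟨γ⟩ : Path V) ∈ x ∧ m.IsPrefix ⟨γ ≫ l.hom⟩ := by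
  rw [push, dif_pos h]
  rfl

open Classical in
/-- The infinite path `y` with `x = ly`, if `l` is an initial segment of `x` (and `x` otherwise). -/
noncomputable def pull (l : Path V) (x : InfinitePath G) : InfinitePath G :=
  if h : l ∈ x then
  { segments := {m | ∃ (a : V) (γ : a ⟶ l.src), m = ⟨γ⟩ ∧ (⟨γ ≫ l.hom⟩ : Path V) ∈ x}
    prefix_mem := by
      rintro ⟨m⟩ _ hm ⟨a, γ, rfl, hγ⟩
      obtain rfl := hm.ran_eq
      exact ⟨_, m, rfl, mem_of_prefix (hm.comp_left l.hom) hγ⟩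
    deg_inj := by
      rintro _ _ ⟨a, γ, rfl, hγ⟩ ⟨b, δ, rfl, hδ⟩ hd
      refine (G.comp_inj (l := l.hom) (l' := l.hom) (eq_of_deg_eq hγ hδ ?_) rfl).2
      rw [G.deg_comp, G.deg_comp, hd]
    exists_mem := by
      intro n
      obtain ⟨m, hm, hd⟩ := x.exists_deg (G.deg l + n)
      obtain ⟨a, γ, rfl⟩ := isPrefix_of_le h hm (hd ▸ le_self_add)
      refine ⟨⟨γ⟩, ⟨a, γ, rfl, hm⟩, ?_⟩
      rw [G.deg_comp] at hd
      exact add_left_cancel hd }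
  else x

theorem mem_pull {l : Path V} {x : InfinitePath G} (h : l ∈ x) {m : Path V} :
    m ∈ pull l x ↔ ∃ (a : V) (γ : a ⟶ l.src), m = ⟨γ⟩ ∧ (⟨γ ≫ l.hom⟩ : Path V) ∈ x := by
  rw [pull, dif_pos h]
  rfl

theorem hom_mem_pull {a b c : V} {l : b ⟶ c} {γ : a ⟶ b} {x : InfinitePath G}
    (h : (⟨l⟩ : Path V) ∈ x) : (⟨γ⟩ : Path V) ∈ pull ⟨l⟩ x ↔ (⟨γ ≫ l⟩ : Path V) ∈ x := by
  rw [mem_pull h]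
  constructor
  · rintro ⟨a', γ', h1, h2⟩
    cases h1
    exact h2
  · exact fun h => ⟨a, γ, rfl, h⟩

theorem comp_mem_push {a : V} {l : Path V} {γ : a ⟶ l.src} {x : InfinitePath G}
    (h : (⟨γ⟩ : Path V) ∈ x) : (⟨γ ≫ l.hom⟩ : Path V) ∈ push l x :=
  (mem_push (vertex_mem h)).2 ⟨a, γ, h, Path.IsPrefix.refl _⟩

theorem mem_push_self {l : Path V} {x : InfinitePath G} (h : Path.vertex l.src ∈ x) :
    l ∈ push l x :=
  (mem_push h).2 ⟨_, 𝟙 _, h, Path.IsPrefix.comp _ _⟩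

theorem ran_mem_push {l : Path V} {x : InfinitePath G} (h : Path.vertex l.src ∈ x) :
    Path.vertex l.ran ∈ push l x := vertex_mem (mem_push_self h)

theorem src_mem_pull {l : Path V} {x : InfinitePath G} (h : l ∈ x) :
    Path.vertex l.src ∈ pull l x :=
  (mem_pull h).2 ⟨_, 𝟙 _, rfl, by simpa using h⟩

theorem pull_push {l : Path V} {x : InfinitePath G} (h : Path.vertex l.src ∈ x) :
    pull l (push l x) = x := by
  refine ext_mem fun m => ?_
  rw [mem_pull (mem_push_self h)]
  constructor
  · rintro ⟨a, γ, rfl, hγ⟩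
    obtain ⟨b, δ, hδ, c, ε, hε⟩ := (mem_push h).1 hγ
    refine mem_of_prefix ?_ hδ
    -- Here lδ = lγε; cancelling l gives δ = γε, so γ is an initial segment of δ.
    have := (G.comp_inj (l := l.hom) (l' := l.hom) (m := δ) (m' := ε ≫ γ)
      (by simpa using hε) rfl).2
    exact ⟨c, ε, this⟩
  · intro hm
    obtain ⟨m⟩ := m
    obtain rfl := ran_eq hm h
    exact ⟨_, m, rfl, comp_mem_push hm⟩

theorem push_pull {l : Path V} {x : InfinitePath G} (h : l ∈ x) : push l (pull l x) = x := by
  refine ext_mem fun m => ?_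
  rw [mem_push (src_mem_pull h)]
  constructor
  · rintro ⟨a, γ, hγ, hm⟩
    exact mem_of_prefix hm ((hom_mem_pull h).1 hγ)
  · intro hm
    obtain ⟨n, hn, ⟨a, γ, rfl⟩, h2⟩ := exists_common h hm
    exact ⟨a, γ, (hom_mem_pull h).2 hn, h2⟩

theorem comp_mem_iff {a b c : V} {l : b ⟶ c} {m : a ⟶ b} {x : InfinitePath G} :
    (⟨m ≫ l⟩ : Path V) ∈ x ↔ (⟨l⟩ : Path V) ∈ x ∧ (⟨m⟩ : Path V) ∈ pull ⟨l⟩ x := by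
  constructor
  · intro h
    have h' := mem_of_prefix (Path.IsPrefix.comp m l) h
    exact ⟨h', (hom_mem_pull h').2 h⟩
  · rintro ⟨h, h'⟩
    exact (hom_mem_pull h).1 h'

theorem pull_comp {a b c : V} {l : b ⟶ c} {m : a ⟶ b} {x : InfinitePath G}
    (h : (⟨m ≫ l⟩ : Path V) ∈ x) : pull ⟨m ≫ l⟩ x = pull ⟨m⟩ (pull ⟨l⟩ x) := by
  obtain ⟨h1, h2⟩ := comp_mem_iff.1 h
  refine ext_mem fun n => ?_
  rw [mem_pull h, mem_pull h2]
  refine exists_congr fun d => exists_congr fun γ => and_congr_right fun _ => ?_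
  rw [hom_mem_pull h1, Category.assoc]

theorem push_comp {a b c : V} {l : b ⟶ c} {m : a ⟶ b} {x : InfinitePath G}
    (h : Path.vertex a ∈ x) : push ⟨m ≫ l⟩ x = push ⟨l⟩ (push ⟨m⟩ x) := by
  have h1 : Path.vertex b ∈ push ⟨m⟩ x := ran_mem_push (l := ⟨m⟩) h
  have h2 : (⟨m ≫ l⟩ : Path V) ∈ push ⟨l⟩ (push ⟨m⟩ x) :=
    comp_mem_push (l := ⟨l⟩) (mem_push_self (l := ⟨m⟩) h)
  -- The right-hand side begins with the path lm, so it is determined by what remains after removing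
  -- lm, and that is x.
  rw [← push_pull h2, pull_comp h2, pull_push (l := ⟨l⟩) h1, pull_push (l := ⟨m⟩) h]

theorem pull_vertex {v : V} {x : InfinitePath G} (h : Path.vertex v ∈ x) :
    pull (Path.vertex v) x = x := by
  refine ext_mem fun m => ?_
  rw [mem_pull h]
  constructor
  · rintro ⟨a, γ, rfl, hγ⟩
    have hγ' : γ ≫ 𝟙 v = γ := Category.comp_id γ
    exact hγ' ▸ hγ
  · intro hm
    obtain ⟨m⟩ := m
    obtain rfl := ran_eq hm h
    exact ⟨_, m, rfl, by simpa [Path.vertex] using hm⟩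

theorem push_vertex {v : V} {x : InfinitePath G} (h : Path.vertex v ∈ x) :
    push (Path.vertex v) x = x := by
  conv_lhs => rw [← pull_vertex h]
  exact push_pull h

/-- Without sources, v extends to a chain of paths of degrees (j, ..., j). These degrees are cofinal
in ℕ^k, so the initial segments of the chain form an infinite path. It supplies the points at which
operators are tested. -/
theorem exists_vertex_mem (hG : G.NoSources) (v : V) : ∃ x : InfinitePath G, Path.vertex v ∈ x := by
  have step : ∀ l : Path V, ∃ m : Path V, l.IsPrefix m ∧ G.deg m = G.deg l + 1 := by
    intro l
    obtain ⟨⟨γ⟩, rfl, hd⟩ := hG l.src 1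
    exact ⟨⟨γ ≫ l.hom⟩, Path.IsPrefix.comp _ _, by rw [G.deg_comp, hd]⟩
  choose f hf hfd using step
  let q : ℕ → Path V := fun j => f^[j] (Path.vertex v)
  have hq : ∀ j, q (j + 1) = f (q j) := fun j => Function.iterate_succ_apply' _ _ _
  have hqd : ∀ j, G.deg (q j) = fun _ => j := by
    intro j
    induction j with
    | zero => exact G.deg_vertex v
    | succ j ih => rw [hq, hfd, ih]; rfl
  have hqm : ∀ i j, i ≤ j → (q i).IsPrefix (q j) := by
    intro i j hij
    induction j, hij using Nat.le_induction with
    | base => exact Path.IsPrefix.refl _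
    | succ j _ ih => exact ih.trans (hq j ▸ hf _)
  refine ⟨⟨{l | ∃ j, l.IsPrefix (q j)}, ?_, ?_, ?_⟩, 0, Path.IsPrefix.refl _⟩
  · rintro l m h ⟨j, hj⟩
    exact ⟨j, h.trans hj⟩
  · rintro l m ⟨i, hi⟩ ⟨j, hj⟩ hd
    exact G.prefix_unique (hi.trans (hqm i (max i j) (le_max_left _ _)))
      (hj.trans (hqm j (max i j) (le_max_right _ _))) hd
  · intro n
    -- The sum of the coordinates of n bounds each of them, so this member of the chain has degree
    -- at least n.
    obtain ⟨m, hm, hd⟩ := G.exists_prefix (q (∑ i, n i)) n (by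
      rw [hqd]
      exact fun i => Finset.single_le_sum (fun _ _ => Nat.zero_le _) (Finset.mem_univ i))
    exact ⟨m, ⟨_, hm⟩, hd⟩

end InfinitePath

end Paths

/-! ### The graded infinite-path representation. -/

noncomputable section Representation

variable {k : ℕ} {V : Type u} [Category.{w} V] (G : KGraph k V) (R : Type y) [CommRing R]

/-- The `R`-module on which the Kumjian-Pask algebra acts: functions on infinite paths with a
grading coordinate. -/
abbrev Space : Type _ := InfinitePath G × (Fin k → ℤ) → R

/-- The degree of a path as an integer vector. -/
def KGraph.degInt (l : Path V) : Fin k → ℤ := fun i => (G.deg l i : ℤ)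

theorem KGraph.degInt_vertex (v : V) : G.degInt (Path.vertex v) = 0 := by
  funext i
  simp [KGraph.degInt, G.deg_vertex]

theorem KGraph.degInt_comp {a b c : V} (l : b ⟶ c) (m : a ⟶ b) :
    G.degInt ⟨m ≫ l⟩ = G.degInt ⟨l⟩ + G.degInt ⟨m⟩ := by
  funext i
  simp [KGraph.degInt, G.deg_comp]

theorem KGraph.degInt_inj {l m : Path V} : G.degInt l = G.degInt m ↔ G.deg l = G.deg m := by
  simp [KGraph.degInt, funext_iff]

open InfinitePath

open Classical in
/-- The projection onto the functions supported on the infinite paths with range `v`. -/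
def vertexOp (v : V) : Module.End R (Space G R) where
  toFun f q := if Path.vertex v ∈ q.1 then f q else 0
  map_add' f g := by funext q; by_cases h : Path.vertex v ∈ q.1 <;> simp [h]
  map_smul' t f := by funext q; by_cases h : Path.vertex v ∈ q.1 <;> simp [h]

open Classical in
/-- The action of `s_l`. -/
def pathOp (l : Path V) : Module.End R (Space G R) where
  toFun f q := if l ∈ q.1 then f (pull l q.1, q.2 - G.degInt l) else 0
  map_add' f g := by funext q; by_cases h : l ∈ q.1 <;> simp [h]
  map_smul' t f := by funext q; by_cases h : l ∈ q.1 <;> simp [h]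

open Classical in
/-- The action of `s_{l^*}`. -/
def ghostOp (l : Path V) : Module.End R (Space G R) where
  toFun f q := if Path.vertex l.src ∈ q.1 then f (push l q.1, q.2 + G.degInt l) else 0
  map_add' f g := by funext q; by_cases h : Path.vertex l.src ∈ q.1 <;> simp [h]
  map_smul' t f := by funext q; by_cases h : Path.vertex l.src ∈ q.1 <;> simp [h]

variable {G R}

open Classical in
theorem vertexOp_apply (v : V) (f : Space G R) (x : InfinitePath G) (n : Fin k → ℤ) :
    vertexOp G R v f (x, n) = if Path.vertex v ∈ x then f (x, n) else 0 := rfl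

open Classical in
theorem pathOp_apply (l : Path V) (f : Space G R) (x : InfinitePath G) (n : Fin k → ℤ) :
    pathOp G R l f (x, n) = if l ∈ x then f (pull l x, n - G.degInt l) else 0 := rfl

open Classical in
theorem ghostOp_apply (l : Path V) (f : Space G R) (x : InfinitePath G) (n : Fin k → ℤ) :
    ghostOp G R l f (x, n) =
      if Path.vertex l.src ∈ x then f (push l x, n + G.degInt l) else 0 := rfl

open Classical in
theorem pathOp_mul_ghostOp_apply (l : Path V) (f : Space G R) (x : InfinitePath G)
    (n : Fin k → ℤ) :
    (pathOp G R l * ghostOp G R l) f (x, n) = if l ∈ x then f (x, n) else 0 := by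
  rw [Module.End.mul_apply, pathOp_apply]
  refine if_ctx_congr Iff.rfl (fun h => ?_) fun _ => rfl
  rw [ghostOp_apply, if_pos (src_mem_pull h), push_pull h, sub_add_cancel]

variable (G R)

-- (KP3) and (KP4) both reflect that an infinite path has exactly one initial segment of each
-- degree: cylinders of distinct paths of equal degree are disjoint, and those of the paths in vΛ^n
-- partition the infinite paths with range v.
open Classical in
theorem isFamily_operators : IsFamily G (vertexOp G R) (pathOp G R) (ghostOp G R) := by
  intro A B h
  refine LinearMap.ext fun f => funext fun ⟨x, n⟩ => ?_
  cases h with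
  | S_vertex v =>
    rw [pathOp_apply, vertexOp_apply]
    refine if_ctx_congr Iff.rfl (fun h => ?_) fun _ => rfl
    rw [pull_vertex h, G.degInt_vertex, sub_zero]
  | T_vertex v =>
    rw [ghostOp_apply, vertexOp_apply]
    refine if_ctx_congr Iff.rfl (fun h => ?_) fun _ => rfl
    rw [push_vertex h, G.degInt_vertex, add_zero]
  | P_idem v =>
    simp only [Module.End.mul_apply, vertexOp_apply]
    by_cases h : Path.vertex v ∈ x <;> simp [h]
  | P_orth hv =>
    simp only [Module.End.mul_apply, vertexOp_apply, LinearMap.zero_apply, Pi.zero_apply]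
    split_ifs with h h'
    · exact absurd (ran_eq h h') hv
    · rfl
    · rfl
  | S_mul l m _ _ =>
    simp only [Module.End.mul_apply, pathOp_apply]
    by_cases h : (⟨m ≫ l⟩ : Path V) ∈ x
    · obtain ⟨h1, h2⟩ := comp_mem_iff.1 h
      rw [if_pos h, if_pos h1, if_pos h2, pull_comp h, G.degInt_comp, sub_sub]
    · rw [if_neg h]
      split_ifs with h1 h2
      · exact absurd (comp_mem_iff.2 ⟨h1, h2⟩) h
      · rfl
      · rfl
  | T_mul l m _ _ =>
    simp only [Module.End.mul_apply, ghostOp_apply]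
    refine if_ctx_congr Iff.rfl (fun h => ?_) fun _ => rfl
    rw [if_pos (ran_mem_push h), push_comp h, G.degInt_comp, add_assoc, add_comm (G.degInt ⟨l⟩)]
  | P_mul_S l _ =>
    simp only [Module.End.mul_apply, vertexOp_apply, pathOp_apply]
    split_ifs with h1 h2 h2
    · rfl
    · rfl
    · exact absurd (vertex_mem h2) h1
    · rfl
  | S_mul_P l _ =>
    simp only [Module.End.mul_apply, vertexOp_apply, pathOp_apply]
    refine if_ctx_congr Iff.rfl (fun h => ?_) fun _ => rfl
    rw [if_pos (src_mem_pull h)]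
  | P_mul_T l _ =>
    simp only [Module.End.mul_apply, vertexOp_apply, ghostOp_apply]
    by_cases h : Path.vertex l.src ∈ x <;> simp [h]
  | T_mul_P l _ =>
    simp only [Module.End.mul_apply, vertexOp_apply, ghostOp_apply]
    refine if_ctx_congr Iff.rfl (fun h => ?_) fun _ => rfl
    rw [if_pos (ran_mem_push h)]
  | T_mul_S l _ =>
    simp only [Module.End.mul_apply, vertexOp_apply, ghostOp_apply, pathOp_apply]
    refine if_ctx_congr Iff.rfl (fun h => ?_) fun _ => rfl
    rw [if_pos (mem_push_self h), pull_push h, add_sub_cancel_right]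
  | T_mul_S_ne _ _ hd hne =>
    simp only [Module.End.mul_apply, ghostOp_apply, pathOp_apply, LinearMap.zero_apply,
      Pi.zero_apply]
    split_ifs with h h'
    · exact absurd (eq_of_deg_eq (mem_push_self h) h' hd) hne
    · rfl
    · rfl
  | P_eq_sum v m F _ hF =>
    have hmem : ∀ l, l ∈ F ↔ l.ran = v ∧ G.deg l = m := fun l => by
      rw [← Finset.mem_coe, hF]; rfl
    rw [LinearMap.sum_apply, Finset.sum_apply, vertexOp_apply]
    simp only [pathOp_mul_ghostOp_apply]
    split_ifs with h
    · obtain ⟨a, γ, hγ, hd⟩ := exists_deg_of_vertex h m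
      rw [Finset.sum_eq_single_of_mem ⟨γ⟩ ((hmem _).2 ⟨rfl, hd⟩), if_pos hγ]
      intro l hl hne
      exact if_neg fun hlx => hne (eq_of_deg_eq hlx hγ (((hmem l).1 hl).2.trans hd.symm))
    · refine (Finset.sum_eq_zero fun l hl => if_neg fun hlx => h ?_).symm
      rw [← ((hmem l).1 hl).1]
      exact vertex_mem hlx

/-- The representation of the Kumjian-Pask algebra on functions on graded infinite paths. -/
def rep : KPAlgebra R G →ₙₐ[R] Module.End R (Space G R) :=
  (KPAlgebra.existsUnique_hom R G (isFamily_operators G R)).choose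

theorem rep_s (l : Path V) : rep G R (KPAlgebra.s R G l) = pathOp G R l :=
  (KPAlgebra.existsUnique_hom R G (isFamily_operators G R)).choose_spec.1.2.1 l

theorem rep_sStar (l : Path V) : rep G R (KPAlgebra.sStar R G l) = ghostOp G R l :=
  (KPAlgebra.existsUnique_hom R G (isFamily_operators G R)).choose_spec.1.2.2 l

variable {G R}

open Classical in
theorem rep_projection_apply (l : Path V) (f : Space G R) (x : InfinitePath G) (n : Fin k → ℤ) :
    rep G R (KPAlgebra.s R G l * KPAlgebra.sStar R G l) f (x, n) =
      if l ∈ x then f (x, n) else 0 := by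
  rw [map_mul, rep_s, rep_sStar, pathOp_mul_ghostOp_apply]

open Classical in
theorem rep_mul_apply {l m : Path V} (h : l.src = m.src) (f : Space G R) (x : InfinitePath G)
    (n : Fin k → ℤ) :
    rep G R (KPAlgebra.s R G l * KPAlgebra.sStar R G m) f (x, n) =
      if l ∈ x then f (push m (pull l x), n - G.degInt l + G.degInt m) else 0 := by
  rw [map_mul, rep_s, rep_sStar, Module.End.mul_apply, pathOp_apply]
  refine if_ctx_congr Iff.rfl (fun hl => ?_) fun _ => rfl
  rw [ghostOp_apply, if_pos (h ▸ src_mem_pull hl)]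

end Representation

/-! ### The Kumjian-Pask relations for paths of arbitrary degree, vertices included. -/

section Family

variable {k : ℕ} {V : Type u} [Category.{w} V] {G : KGraph k V} {A : Type x} [NonUnitalRing A]
  {P : V → A} {S T : Path V → A}

namespace IsFamily

theorem S_vertex (h : IsFamily G P S T) (v : V) : S (Path.vertex v) = P v :=
  h _ _ (.S_vertex v)

theorem T_vertex (h : IsFamily G P S T) (v : V) : T (Path.vertex v) = P v :=
  h _ _ (.T_vertex v)

theorem P_mul_S (h : IsFamily G P S T) (l : Path V) : P l.ran * S l = S l := by
  by_cases hl : G.deg l = 0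
  · rw [G.eq_vertex hl, h.S_vertex]
    exact h _ _ (.P_idem _)
  · exact h _ _ (.P_mul_S l hl)

theorem S_mul_P (h : IsFamily G P S T) (l : Path V) : S l * P l.src = S l := by
  by_cases hl : G.deg l = 0
  · rw [G.eq_vertex hl, h.S_vertex]
    exact h _ _ (.P_idem _)
  · exact h _ _ (.S_mul_P l hl)

theorem P_mul_T (h : IsFamily G P S T) (l : Path V) : P l.src * T l = T l := by
  by_cases hl : G.deg l = 0
  · rw [G.eq_vertex hl, h.T_vertex]
    exact h _ _ (.P_idem _)
  · exact h _ _ (.P_mul_T l hl)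

theorem T_mul_P (h : IsFamily G P S T) (l : Path V) : T l * P l.ran = T l := by
  by_cases hl : G.deg l = 0
  · rw [G.eq_vertex hl, h.T_vertex]
    exact h _ _ (.P_idem _)
  · exact h _ _ (.T_mul_P l hl)

theorem S_mul_S (h : IsFamily G P S T) {a b c : V} (l : b ⟶ c) (m : a ⟶ b) :
    S ⟨l⟩ * S ⟨m⟩ = S ⟨m ≫ l⟩ := by
  by_cases hl : G.deg ⟨l⟩ = 0
  · have hv : (⟨l⟩ : Path V) = ⟨𝟙 c⟩ := G.eq_vertex hl
    cases hv
    have h1 := h.P_mul_S ⟨m⟩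
    rw [← h.S_vertex] at h1
    rw [Category.comp_id]
    exact h1
  by_cases hm : G.deg ⟨m⟩ = 0
  · have hv : (⟨m⟩ : Path V) = ⟨𝟙 b⟩ := G.eq_vertex hm
    cases hv
    have h1 := h.S_mul_P ⟨l⟩
    rw [← h.S_vertex] at h1
    rw [Category.id_comp]
    exact h1
  exact h _ _ (.S_mul l m hl hm)

theorem T_mul_T (h : IsFamily G P S T) {a b c : V} (l : b ⟶ c) (m : a ⟶ b) :
    T ⟨m⟩ * T ⟨l⟩ = T ⟨m ≫ l⟩ := by
  by_cases hl : G.deg ⟨l⟩ = 0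
  · have hv : (⟨l⟩ : Path V) = ⟨𝟙 c⟩ := G.eq_vertex hl
    cases hv
    have h1 := h.T_mul_P ⟨m⟩
    rw [← h.T_vertex] at h1
    rw [Category.comp_id]
    exact h1
  by_cases hm : G.deg ⟨m⟩ = 0
  · have hv : (⟨m⟩ : Path V) = ⟨𝟙 b⟩ := G.eq_vertex hm
    cases hv
    have h1 := h.P_mul_T ⟨l⟩
    rw [← h.T_vertex] at h1
    rw [Category.id_comp]
    exact h1
  exact h _ _ (.T_mul l m hl hm)

theorem T_mul_S (h : IsFamily G P S T) (l : Path V) : T l * S l = P l.src := by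
  by_cases hl : G.deg l = 0
  · rw [G.eq_vertex hl, h.T_vertex, h.S_vertex]
    exact h _ _ (.P_idem _)
  · exact h _ _ (.T_mul_S l hl)

theorem T_mul_S_of_ne (h : IsFamily G P S T) {l m : Path V} (hd : G.deg l = G.deg m)
    (hne : l ≠ m) : T l * S m = 0 := by
  by_cases hl : G.deg l = 0
  · have hm : G.deg m = 0 := hd ▸ hl
    have hv : l.ran ≠ m.ran := fun e => hne (by rw [G.eq_vertex hl, G.eq_vertex hm, e])
    rw [G.eq_vertex hl, G.eq_vertex hm, h.T_vertex, h.S_vertex]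
    exact h _ _ (.P_orth hv)
  · exact h _ _ (.T_mul_S_ne hl (hd ▸ hl) hd hne)

theorem P_eq_sum (h : IsFamily G P S T) (v : V) (n : Fin k → ℕ) (F : Finset (Path V))
    (hF : (F : Set (Path V)) = G.pathsTo v n) : P v = ∑ l ∈ F, S l * T l := by
  by_cases hn : n = 0
  · have hF' : F = {Path.vertex v} := by
      ext l
      rw [← Finset.mem_coe, hF, Finset.mem_singleton]
      constructor
      · rintro ⟨rfl, hd⟩
        exact G.eq_vertex (hd.trans hn)
      · rintro rfl
        exact ⟨rfl, (G.deg_vertex v).trans hn.symm⟩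
    rw [hF', Finset.sum_singleton, h.S_vertex, h.T_vertex]
    exact (h _ _ (.P_idem v)).symm
  · exact h _ _ (.P_eq_sum v n F hn hF)

end IsFamily

end Family

/-! ### Normal forms with a common ghost degree. -/

noncomputable section NormalForm

variable {k : ℕ} {V : Type u} [Category.{w} V] (R : Type y) [CommRing R] (G : KGraph k V)

/-- The element `s_α s_{β^*}` attached to a pair of paths. -/
def standardElement (q : Path V × Path V) : KPAlgebra R G :=
  KPAlgebra.s R G q.1 * KPAlgebra.sStar R G q.2

/-- The span of the elements `s_α s_{β^*}` with `s(α) = s(β)` and `d(β) = n`. -/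
def level (n : Fin k → ℕ) : Submodule R (KPAlgebra R G) :=
  Submodule.span R (standardElement R G '' {q | q.1.src = q.2.src ∧ G.deg q.2 = n})

variable {R G}

theorem mem_level {v a b : V} (α : v ⟶ a) (β : v ⟶ b) :
    KPAlgebra.s R G ⟨α⟩ * KPAlgebra.sStar R G ⟨β⟩ ∈ level R G (G.deg ⟨β⟩) :=
  Submodule.subset_span ⟨(⟨α⟩, ⟨β⟩), ⟨rfl, rfl⟩, rfl⟩

/-- Expanding `s_α s_{β^*}` along all paths of degree `n` with range `s(α)`. -/
theorem standard_eq_sum {v a b : V} (α : v ⟶ a) (β : v ⟶ b) (n : Fin k → ℕ)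
    (F : Finset (Path V)) (hF : (F : Set (Path V)) = G.pathsTo v n) :
    KPAlgebra.s R G ⟨α⟩ * KPAlgebra.sStar R G ⟨β⟩ =
      ∑ l ∈ F, (KPAlgebra.s R G ⟨α⟩ * KPAlgebra.s R G l) *
        (KPAlgebra.sStar R G l * KPAlgebra.sStar R G ⟨β⟩) := by
  have h := KPAlgebra.isFamily R G
  have h1 := h.S_mul_P ⟨α⟩
  rw [h.P_eq_sum v n F hF] at h1
  conv_lhs => rw [← h1]
  simp only [Finset.mul_sum, Finset.sum_mul, mul_assoc]

/-- To show that `s_α s_{β^*}` lies in a submodule, one may extend `α` and `β` by all paths of a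
fixed degree. -/
theorem standard_induction (hfin : G.RowFinite) (n : Fin k → ℕ)
    (W : Submodule R (KPAlgebra R G)) {v a b : V} (α : v ⟶ a) (β : v ⟶ b)
    (f : KPAlgebra R G →ₗ[R] KPAlgebra R G)
    (hW : ∀ (c : V) (γ : c ⟶ v), G.deg ⟨γ⟩ = n →
      f (KPAlgebra.s R G ⟨γ ≫ α⟩ * KPAlgebra.sStar R G ⟨γ ≫ β⟩) ∈ W) :
    f (KPAlgebra.s R G ⟨α⟩ * KPAlgebra.sStar R G ⟨β⟩) ∈ W := by
  have h := KPAlgebra.isFamily R G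
  rw [standard_eq_sum α β n (hfin v n).toFinset (Set.Finite.coe_toFinset _), map_sum]
  refine Submodule.sum_mem _ fun l hl => ?_
  obtain ⟨rfl, hd⟩ := (Set.Finite.mem_toFinset _).1 hl
  obtain ⟨γ⟩ := l
  rw [h.S_mul_S, h.T_mul_T]
  exact hW _ γ hd

theorem level_le_level_add (hfin : G.RowFinite) (n m : Fin k → ℕ) :
    level R G n ≤ level R G (n + m) := by
  refine Submodule.span_le.2 ?_
  rintro _ ⟨⟨⟨α⟩, ⟨β⟩⟩, ⟨hs, rfl⟩, rfl⟩
  dsimp only at hs ⊢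
  subst hs
  refine standard_induction hfin m _ α β LinearMap.id fun c γ hγ => ?_
  rw [← hγ, ← G.deg_comp]
  exact mem_level _ _

/-- The levels are therefore directed, and a sum of elements from two levels lies in the level of
the join. -/
theorem level_mono (hfin : G.RowFinite) {n m : Fin k → ℕ} (h : n ≤ m) :
    level R G n ≤ level R G m := by
  rw [← add_tsub_cancel_of_le h]
  exact level_le_level_add hfin _ _

theorem p_mul_mem_level (v : V) {n : Fin k → ℕ} {a : KPAlgebra R G} (ha : a ∈ level R G n) :
    KPAlgebra.p R G v * a ∈ level R G n := by
  have h := KPAlgebra.isFamily R G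
  suffices level R G n ≤ (level R G n).comap (LinearMap.mulLeft R (KPAlgebra.p R G v)) from this ha
  refine Submodule.span_le.2 ?_
  rintro _ ⟨⟨α, β⟩, ⟨hs, rfl⟩, rfl⟩
  change KPAlgebra.p R G v * (KPAlgebra.s R G α * KPAlgebra.sStar R G β) ∈ level R G (G.deg β)
  by_cases hv : v = α.ran
  · rw [← mul_assoc, hv, h.P_mul_S]
    exact Submodule.subset_span ⟨(α, β), ⟨hs, rfl⟩, rfl⟩
  · rw [← mul_assoc, ← h.P_mul_S α, ← mul_assoc, h _ _ (.P_orth hv), zero_mul, zero_mul]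
    exact zero_mem _

theorem s_mul_mem_level (l : Path V) {n : Fin k → ℕ} {a : KPAlgebra R G} (ha : a ∈ level R G n) :
    KPAlgebra.s R G l * a ∈ level R G n := by
  have h := KPAlgebra.isFamily R G
  suffices level R G n ≤ (level R G n).comap (LinearMap.mulLeft R (KPAlgebra.s R G l)) from this ha
  refine Submodule.span_le.2 ?_
  rintro _ ⟨⟨⟨α⟩, β⟩, ⟨hs, rfl⟩, rfl⟩
  change KPAlgebra.s R G l * (KPAlgebra.s R G ⟨α⟩ * KPAlgebra.sStar R G β) ∈ level R G (G.deg β)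
  obtain ⟨l⟩ := l
  rename_i a b c d
  by_cases hv : c = b
  · subst hv
    rw [← mul_assoc, h.S_mul_S]
    exact Submodule.subset_span ⟨(⟨α ≫ l⟩, β), ⟨hs, rfl⟩, rfl⟩
  · rw [← mul_assoc, ← h.P_mul_S ⟨α⟩, ← h.S_mul_P ⟨l⟩, mul_assoc (KPAlgebra.s R G _),
      ← mul_assoc (KPAlgebra.p R G _), h _ _ (.P_orth hv), zero_mul, mul_zero, zero_mul]
    exact zero_mem _

/-- Extending α and β by all γ of degree d(l) makes αγ long enough to split as mν with d(m) = d(l).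
By (KP3) the product s_{l^*} s_m s_ν s_{(βγ)^*} is s_ν s_{(βγ)^*} if m = l and zero otherwise. The
extension of β accounts for the rise in level by d(l). -/
theorem sStar_mul_mem_level (hfin : G.RowFinite) (l : Path V) {n : Fin k → ℕ} {a : KPAlgebra R G}
    (ha : a ∈ level R G n) : KPAlgebra.sStar R G l * a ∈ level R G (n + G.deg l) := by
  have h := KPAlgebra.isFamily R G
  suffices level R G n ≤
    (level R G (n + G.deg l)).comap (LinearMap.mulLeft R (KPAlgebra.sStar R G l)) from this ha
  refine Submodule.span_le.2 ?_
  rintro _ ⟨⟨⟨α⟩, ⟨β⟩⟩, ⟨hs, rfl⟩, rfl⟩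
  dsimp only at hs ⊢
  subst hs
  refine standard_induction hfin (G.deg l) (level R G (G.deg ⟨β⟩ + G.deg l)) α β
    (LinearMap.mulLeft R (KPAlgebra.sStar R G l)) fun c γ hγ => ?_
  obtain ⟨m, ⟨_, ν, hm⟩, hd⟩ := G.exists_prefix ⟨γ ≫ α⟩ (G.deg l) (by
    rw [G.deg_comp, hγ]; exact le_add_self)
  obtain ⟨m⟩ := m
  cases congrArg Path.src hm
  rw [LinearMap.mulLeft_apply, hm, ← hγ, ← G.deg_comp, ← h.S_mul_S, mul_assoc, ← mul_assoc]
  by_cases hlm : l = ⟨m⟩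
  · subst hlm
    rw [h.T_mul_S, ← mul_assoc]
    have h1 := h.P_mul_S ⟨ν⟩
    rw [h1]
    exact mem_level _ _
  · rw [h.T_mul_S_of_ne hd.symm hlm, zero_mul]
    exact zero_mem _

/-- Every element of the Kumjian-Pask algebra has a normal form. -/
theorem exists_mem_level (hfin : G.RowFinite) (a : KPAlgebra R G) : ∃ n, a ∈ level R G n := by
  have h := KPAlgebra.isFamily R G
  obtain ⟨f, rfl⟩ : ∃ f, KPAlgebra.mk R G f = a := Quot.exists_rep a
  have word : ∀ z : FreeSemigroup (Gen V),
      ∃ n, KPAlgebra.mk R G (MonoidAlgebra.single z 1) ∈ level R G n := by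
    intro z
    induction z using FreeSemigroup.recOnMul with
    | ih1 g =>
      cases g with
      | vertex v =>
        refine ⟨G.deg ⟨𝟙 v⟩, ?_⟩
        · change KPAlgebra.p R G v ∈ level R G _
          rw [← h _ _ (.P_idem v), ← h.S_vertex]
          nth_rw 2 [h.S_vertex]
          rw [← h.T_vertex]
          exact mem_level (𝟙 v) (𝟙 v)
      | path l =>
        refine ⟨G.deg ⟨𝟙 l.src⟩, ?_⟩
        · change KPAlgebra.s R G l ∈ level R G _
          rw [← h.S_mul_P, ← h.T_vertex]
          exact mem_level l.hom (𝟙 _)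
      | ghost l =>
        refine ⟨G.deg ⟨l.hom⟩, ?_⟩
        · change KPAlgebra.sStar R G l ∈ level R G _
          rw [← h.P_mul_T, ← h.S_vertex]
          exact mem_level (𝟙 _) l.hom
    | ih2 g z _ ih =>
      obtain ⟨n, hn⟩ := ih
      have hz : (MonoidAlgebra.single (FreeSemigroup.of g * z) 1 : FreeAlg R (Gen V)) =
          FreeAlg.of R g * MonoidAlgebra.single z 1 := by
        rw [FreeAlg.of, MonoidAlgebra.single_mul_single, one_mul]
      rw [hz, map_mul]
      cases g with
      | vertex v => exact ⟨n, p_mul_mem_level v hn⟩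
      | path l => exact ⟨n, s_mul_mem_level l hn⟩
      | ghost l => exact ⟨_, sStar_mul_mem_level hfin l hn⟩
  induction f using MonoidAlgebra.induction_linear with
  | zero => exact ⟨0, by rw [map_zero]; exact zero_mem _⟩
  | add f g hf hg =>
    obtain ⟨n, hn⟩ := hf
    obtain ⟨m, hm⟩ := hg
    refine ⟨n ⊔ m, ?_⟩
    rw [map_add]
    exact add_mem (level_mono hfin le_sup_left hn) (level_mono hfin le_sup_right hm)
  | single z r =>
    obtain ⟨n, hn⟩ := word z
    refine ⟨n, ?_⟩
    have hz : (MonoidAlgebra.single z r : FreeAlg R (Gen V)) =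
        r • MonoidAlgebra.single z 1 := by
      rw [MonoidAlgebra.smul_single, smul_eq_mul, mul_one]
    rw [hz, map_smul]
    exact Submodule.smul_mem _ _ hn

/-- Every element is a linear combination of elements `s_α s_{β^*}` with `d(β)` constant. -/
theorem exists_normalForm (hfin : G.RowFinite) (a : KPAlgebra R G) :
    ∃ (n : Fin k → ℕ) (c : Path V × Path V →₀ R),
      (∀ q ∈ c.support, q.1.src = q.2.src ∧ G.deg q.2 = n) ∧
      a = c.sum fun q r => r • standardElement R G q := by
  obtain ⟨n, hn⟩ := exists_mem_level hfin a
  obtain ⟨c, hc, rfl⟩ := (Finsupp.mem_span_image_iff_linearCombination R).1 hn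
  exact ⟨n, c, fun q hq => (Finsupp.mem_supported R c).1 hc hq, Finsupp.linearCombination_apply R c⟩

end NormalForm

/-! ### Faithfulness, cycline pairs and the commutant of the diagonal. -/

noncomputable section Commutant

variable {k : ℕ} {V : Type u} [Category.{w} V] {R : Type y} [CommRing R] {G : KGraph k V}

open InfinitePath

-- The point mass at (β₀z, d(β₀) - d(α₀)), evaluated after the action at (α₀z, 0), isolates the term
-- q₀ = (α₀, β₀). The common ghost degree is essential: it lets the integer coordinate determine
-- d(α), and initial segments of equal degree of one infinite path coincide.
open Classical in
theorem rep_normalForm_apply {n : Fin k → ℕ} {c : Path V × Path V →₀ R}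
    (hc : ∀ q ∈ c.support, q.1.src = q.2.src ∧ G.deg q.2 = n) {q₀ : Path V × Path V}
    (hq₀ : q₀ ∈ c.support) {z : InfinitePath G} (hz : Path.vertex q₀.1.src ∈ z) :
    rep G R (c.sum fun q r => r • standardElement R G q)
      (Pi.single (push q₀.2 z, 0 - G.degInt q₀.1 + G.degInt q₀.2) 1) (push q₀.1 z, 0) = c q₀ := by
  rw [Finsupp.sum, map_sum, LinearMap.sum_apply, Finset.sum_apply,
    Finset.sum_eq_single_of_mem q₀ hq₀]
  · rw [map_smul, LinearMap.smul_apply, Pi.smul_apply, standardElement,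
      rep_mul_apply (hc _ hq₀).1, if_pos (mem_push_self hz), pull_push hz, Pi.single_eq_same,
      smul_eq_mul, mul_one]
  · intro q hq hne
    rw [map_smul, LinearMap.smul_apply, Pi.smul_apply, standardElement, rep_mul_apply (hc _ hq).1]
    split_ifs with h
    · rw [Pi.single_eq_of_ne, smul_zero]
      intro heq
      obtain ⟨h1, h2⟩ := Prod.mk.inj heq
      have hd : G.deg q.2 = G.deg q₀.2 := (hc _ hq).2.trans (hc _ hq₀).2.symm
      -- The equal ghost degrees cancel, leaving d(α) = d(α₀).
      rw [G.degInt_inj.2 hd, add_left_inj, sub_right_inj] at h2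
      have e1 : q.1 = q₀.1 := eq_of_deg_eq h (mem_push_self hz) (G.degInt_inj.1 h2)
      have e2 : q.2 = q₀.2 := by
        -- By `h1` the path β₀z also begins with β.
        refine eq_of_deg_eq (x := push q₀.2 z) ?_ (mem_push_self ((hc _ hq₀).1 ▸ hz)) hd
        rw [← h1]
        exact mem_push_self ((hc _ hq).1 ▸ src_mem_pull h)
      exact hne (Prod.ext e1 e2)
    · rw [smul_zero]

/-- The representation on functions on graded infinite paths is faithful. -/
theorem rep_injective (hfin : G.RowFinite) (hsrc : G.NoSources) :
    Function.Injective (rep G R) := by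
  classical
  refine (injective_iff_map_eq_zero _).2 fun a ha => ?_
  obtain ⟨n, c, hc, rfl⟩ := exists_normalForm hfin a
  suffices c = 0 by rw [this, Finsupp.sum_zero_index]
  by_contra hne
  obtain ⟨q, hq⟩ := Finsupp.support_nonempty_iff.2 hne
  obtain ⟨z, hz⟩ := exists_vertex_mem hsrc q.1.src
  have h := rep_normalForm_apply hc hq hz
  rw [ha] at h
  exact Finsupp.mem_support_iff.1 hq h.symm

/-- A pair `(α, β)` with `αz = βz` for all infinite paths `z` is cycline. -/
theorem isCyclinePair_of_push_eq (hfin : G.RowFinite) (hsrc : G.NoSources) {v a b : V}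
    {α : v ⟶ a} {β : v ⟶ b}
    (h : ∀ z : InfinitePath G, Path.vertex v ∈ z → push ⟨α⟩ z = push ⟨β⟩ z) :
    IsCyclinePair R G α β := by
  classical
  intro c γ
  refine rep_injective hfin hsrc (LinearMap.ext fun f => funext fun ⟨x, n⟩ => ?_)
  rw [rep_projection_apply, rep_projection_apply]
  -- Quantified afresh over α and β, so that it also applies with their roles exchanged.
  have aux : ∀ {a b : V} {α : v ⟶ a} {β : v ⟶ b},
      (∀ z : InfinitePath G, Path.vertex v ∈ z → push ⟨α⟩ z = push ⟨β⟩ z) →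
      (⟨γ ≫ α⟩ : Path V) ∈ x → (⟨γ ≫ β⟩ : Path V) ∈ x := by
    intro a b α β h hx
    obtain ⟨h1, h2⟩ := comp_mem_iff.1 hx
    rw [← push_pull h1, h _ (src_mem_pull h1)]
    exact comp_mem_push (l := ⟨β⟩) h2
  have hiff : (⟨γ ≫ α⟩ : Path V) ∈ x ↔ (⟨γ ≫ β⟩ : Path V) ∈ x :=
    ⟨aux h, aux fun z hz => (h z hz).symm⟩
  exact if_congr hiff rfl rfl

/-- If `(α, β)` is cycline, then `αz = βz` for all infinite paths `z`. -/
theorem IsCyclinePair.push_eq [Nontrivial R] {v a b : V} {α : v ⟶ a} {β : v ⟶ b}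
    (h : IsCyclinePair R G α β) {z : InfinitePath G} (hz : Path.vertex v ∈ z) :
    push ⟨α⟩ z = push ⟨β⟩ z := by
  have hmem : ∀ {c : V} (γ : c ⟶ v) (x : InfinitePath G),
      (⟨γ ≫ α⟩ : Path V) ∈ x ↔ (⟨γ ≫ β⟩ : Path V) ∈ x := by
    intro c γ x
    -- On the constant function 1 the two projections give cylinder indicators, and 1 ≠ 0 in R
    -- allows membership to be read off.
    have h1 := congrArg (fun A => rep G R A (fun _ => 1) (x, 0)) (h c γ)
    simp only [rep_projection_apply] at h1
    by_cases hα : (⟨γ ≫ α⟩ : Path V) ∈ x <;> by_cases hβ : (⟨γ ≫ β⟩ : Path V) ∈ x <;>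
      simp_all
  refine ext_mem fun m => ⟨fun hm => ?_, fun hm => ?_⟩
  · obtain ⟨c, γ, hγ, hpre⟩ := (mem_push (l := ⟨α⟩) hz).1 hm
    exact mem_of_prefix hpre ((hmem γ _).2 (comp_mem_push (l := ⟨β⟩) hγ))
  · obtain ⟨c, γ, hγ, hpre⟩ := (mem_push (l := ⟨β⟩) hz).1 hm
    exact mem_of_prefix hpre ((hmem γ _).1 (comp_mem_push (l := ⟨α⟩) hγ))

-- Writing x = αz, the cycline condition gives βz = x: only the grading coordinate moves, and by a
-- constant. This shape makes the commutativity of 𝓜 visible.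
open Classical in
theorem IsCyclinePair.rep_apply [Nontrivial R] {v a b : V} {α : v ⟶ a} {β : v ⟶ b}
    (h : IsCyclinePair R G α β) (f : Space G R) (x : InfinitePath G) (n : Fin k → ℤ) :
    rep G R (KPAlgebra.s R G ⟨α⟩ * KPAlgebra.sStar R G ⟨β⟩) f (x, n) =
      if (⟨α⟩ : Path V) ∈ x then f (x, n + (G.degInt ⟨β⟩ - G.degInt ⟨α⟩)) else 0 := by
  rw [rep_mul_apply (l := ⟨α⟩) (m := ⟨β⟩) rfl]
  refine if_ctx_congr Iff.rfl (fun hx => ?_) fun _ => rfl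
  rw [← h.push_eq (src_mem_pull hx), push_pull hx]
  congr 2
  abel

theorem cycline_comm (hfin : G.RowFinite) (hsrc : G.NoSources) {x y : KPAlgebra R G}
    (hx : x ∈ cycline R G) (hy : y ∈ cycline R G) : x * y = y * x := by
  classical
  -- Over the zero ring indicators carry no information, but then the algebra itself is zero.
  rcases subsingleton_or_nontrivial R with hR | hR
  · have := Module.subsingleton R (KPAlgebra R G)
    exact Subsingleton.elim _ _
  refine @setLike_mul_comm _ _ _ _ _ _
    (NonUnitalAlgebra.isMulCommutative_adjoin R ?_) x y hx hy
  rintro A ⟨v, a, b, α, β, h, hA⟩ B ⟨v', a', b', α', β', h', hB⟩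
  have hA' := h.rep_apply
  have hB' := h'.rep_apply
  rw [← hA] at hA'
  rw [← hB] at hB'
  -- On generators, both products restrict to the intersection of two cylinders and translate n by
  -- the sum of two constants.
  refine rep_injective hfin hsrc (LinearMap.ext fun f => funext fun ⟨x, n⟩ => ?_)
  rw [map_mul, map_mul, Module.End.mul_apply, Module.End.mul_apply, hA', hB', hB', hA',
    add_right_comm n]
  by_cases h1 : (⟨α⟩ : Path V) ∈ x <;> by_cases h2 : (⟨α'⟩ : Path V) ∈ x <;> simp [h1, h2]

theorem diagonal_le_cycline : diagonal R G ≤ cycline R G := by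
  refine NonUnitalAlgebra.adjoin_mono ?_
  rintro _ ⟨⟨m⟩, rfl⟩
  exact ⟨_, _, _, m, m, fun _ _ => rfl, rfl⟩

/-- Not only the whole element but each term of its normal form lies in 𝓜: commutation with s_m
s_{m^*} is tested against the point mass that isolates that term. -/
theorem diagonalCommutant_le_cycline (hfin : G.RowFinite) (hsrc : G.NoSources) :
    diagonalCommutant R G ≤ cycline R G := by
  classical
  intro a ha
  obtain ⟨n, c, hc, rfl⟩ := exists_normalForm hfin a
  refine sum_mem fun q hq => SMulMemClass.smul_mem _ ?_
  have hpush : ∀ z : InfinitePath G, Path.vertex q.1.src ∈ z → push q.1 z = push q.2 z := by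
    intro z hz
    refine ext_mem fun m => ?_
    have hcomm := (NonUnitalSubalgebra.mem_centralizer_iff R).1 ha _
      (NonUnitalAlgebra.subset_adjoin R ⟨m, rfl⟩)
    -- With the projection on the left, the value is the coefficient c q if m begins αz and zero
    -- otherwise; on the right, the same with βz. As c q ≠ 0, the two conditions on m agree.
    have happ := congrArg (fun A => rep G R A
      (Pi.single (push q.2 z, 0 - G.degInt q.1 + G.degInt q.2) 1) (push q.1 z, 0)) hcomm
    have hproj : ∀ (y : InfinitePath G) (i : Fin k → ℤ),
        rep G R (KPAlgebra.s R G m * KPAlgebra.sStar R G m) (Pi.single (y, i) 1) =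
          (if m ∈ y then (1 : R) else 0) • Pi.single (y, i) 1 := by
      intro y i
      funext ⟨x, j⟩
      rw [rep_projection_apply, Pi.smul_apply, smul_eq_mul]
      by_cases hxy : (x, j) = (y, i)
      · obtain ⟨rfl, rfl⟩ := Prod.mk.inj hxy
        simp
      · simp [Pi.single_eq_of_ne hxy]
    simp only [map_mul (rep G R) _ (Finsupp.sum c _), map_mul (rep G R) (Finsupp.sum c _) _,
      Module.End.mul_apply, hproj, rep_projection_apply] at happ
    rw [map_smul, Pi.smul_apply, rep_normalForm_apply hc hq hz, smul_eq_mul] at happ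
    have hcq := Finsupp.mem_support_iff.1 hq
    by_cases h1 : m ∈ push q.1 z <;> by_cases h2 : m ∈ push q.2 z <;> simp_all
  have hs := (hc q hq).1
  obtain ⟨⟨α⟩, ⟨β⟩⟩ := q
  dsimp only at hs
  subst hs
  exact NonUnitalAlgebra.subset_adjoin R
    ⟨_, _, _, α, β, isCyclinePair_of_push_eq hfin hsrc hpush, rfl⟩

end Commutant

end KumjianPask

theorem theorem4p4 {k : ℕ} (hk : 0 < k) {V : Type*} [CategoryTheory.Category V]
    (G : KumjianPask.KGraph k V) (hfin : G.RowFinite) (hsrc : G.NoSources)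
    (R : Type*) [CommRing R] :
    KumjianPask.cycline R G = KumjianPask.diagonalCommutant R G ∧
      Maximal
        (fun C : NonUnitalSubalgebra R (KumjianPask.KPAlgebra R G) =>
          ∀ a ∈ C, ∀ b ∈ C, a * b = b * a)
        (KumjianPask.cycline R G) := by
  refine ⟨le_antisymm (fun a ha => ?_) (KumjianPask.diagonalCommutant_le_cycline hfin hsrc),
    fun a ha b hb => KumjianPask.cycline_comm hfin hsrc ha hb, fun C hC hle a ha => ?_⟩
  · exact (NonUnitalSubalgebra.mem_centralizer_iff R).2 fun d hd =>
      KumjianPask.cycline_comm hfin hsrc (KumjianPask.diagonal_le_cycline hd) ha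
  -- A commutative C containing 𝓜 contains 𝓓, hence lies in 𝓓'.
  · refine KumjianPask.diagonalCommutant_le_cycline hfin hsrc ?_
    exact (NonUnitalSubalgebra.mem_centralizer_iff R).2 fun d hd =>
      hC d (hle (KumjianPask.diagonal_le_cycline hd)) a ha
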